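/- **Setting.** There are $K\ge 1$ arms and $M$ hypotheses. An observation from arm $i$ has a distribution from a vector exponential family with density (with respect to a $\sigma$-finite reference measure, e.g. Lebesgue or counting measure on a countable set) $f_i(x\mid\eta)=h_i(x)\exp(\eta^T T_i(x)-\mathcal A_i(\eta))$, where $\eta$ lies in an open convex set $\Psi_i\subset\mathbb R^{d_i}$ and $\mathcal A_i$ is the log-partition function. Write $\overline\eta=(\eta_1,\dots,\eta_K)\in\Omega=\Psi_1\times\dots\times\Psi_K$, let $D(\eta_i\|\eta_i')$ be the relative entropy of $f_i(\cdot\mid\eta_i)$ with respect to $f_i(\cdot\mid\eta_i')$, and let $\Theta_1,\dots,\Theta_M\subset\Omega$ be pairwise disjoint, $\Theta_{-l}=\bigcup_m\Theta_m\setminus\Theta_l$. At each stage $n\ge1$, given the past actions and observations, a policy $\pi$ either stops and declares some $\delta\in\{1,\dots,M\}$, or continues and samples an arm $a_n$ according to a probability distribution on the arms, and then observes $x_n$ from that arm (internal randomisation is allowed). Let $\tau=\inf\{n\ge1:\pi\text{ stops at stage }n\}$, so that $\tau-1$ observations are made ($\tau=\infty$ and no decision is declared if $\pi$ never stops). For $0<\alpha<1$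 let $\Pi(\alpha)$ be the set of policies with $P(\delta\ne l\mid\overline\eta)\le\alpha$ for all $l$ and all $\overline\eta\in\Theta_l$, where never stopping counts as $\delta\neq l$. Let $g(a,a')\ge0$ with $g(a,a)=0$ be switching costs, and $C(\pi)=\tau+\sum_{k=1}^{\tau-1}g(a_k,a_{k+1})$, where a term in which no arm is pulled at stage $k+1$ is $0$. **Statement.** Let $0<\alpha\le 1/2$, $\overline\eta\in\Theta_l$ and $\pi\in\Pi(\alpha)$. Then $$E[\tau\mid\overline\eta]\ \ge\ \frac{d_b(\alpha\|1-\alpha)}{D^*(\overline\eta)},\qquad\text{and even}\qquad E[\tau-1\mid\overline\eta]\ \ge\ \frac{d_b(\alpha\|1-\alpha)}{D^*(\overline\eta)},$$ where $d_b(\alpha\|1-\alpha)=\alpha\log\frac{\alpha}{1-\alpha}+(1-\alpha)\log\frac{1-\alpha}{\alpha}$ and $$D^*(\overline\eta)=\sup_{\lambda}\ \inf_{\overline\eta'\in\Theta_{-l}}\ \sum_{i=1}^K\lambda_i D(\eta_i\|\eta_i'),$$ the supremum being over the probability distributions $\lambda$ on $\{1,\dots,K\}$. Consequently also $$E[C(\pi)\mid\overline\eta]\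 \ge\ \frac{d_b(\alpha\|1-\alpha)}{D^*(\overline\eta)}.$$ Here all quantities are in $[0,\infty]$, with $\inf\emptyset=\infty$, $c/\infty=0$, $c/0=\infty$ for $c>0$, and $0/0=0$. -/

import Mathlib

open MeasureTheory ProbabilityTheory
open scoped ENNReal NNReal

namespace BanditTest

/-! ### Exponential families -/

/-- A vector exponential family on the observation space `𝓧`, in canonical form: the density with
respect to the reference measure `ref` (Lebesgue measure for densities, counting measure on a
countable set for mass functions) is `h x * exp (⟪η, T x⟫ - A η)`, with the natural parameter `η`
in an open convex set `Ψ`.  The two last fields say that the normalising integral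
`∫ h x * exp ⟪η, T x⟫` converges and is not zero, i.e. that there is a density to normalise. -/
structure ExpFamily (𝓧 : Type*) [MeasurableSpace 𝓧] where
  /-- dimension of the natural parameter -/
  dim : ℕ
  /-- reference measure -/
  ref : Measure 𝓧
  sigmaFinite_ref : SigmaFinite ref
  /-- carrier function -/
  h : 𝓧 → ℝ
  measurable_h : Measurable h
  h_nonneg : ∀ x, 0 ≤ h x
  /-- sufficient statistic -/
  T : 𝓧 → EuclideanSpace ℝ (Fin dim)
  measurable_T : Measurable T
  /-- set of natural parameters -/
  Ψ : Set (EuclideanSpace ℝ (Fin dim))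
  isOpen_Ψ : IsOpen Ψ
  convex_Ψ : Convex ℝ Ψ
  integrable_exp : ∀ η ∈ Ψ, Integrable (fun x => h x * Real.exp (inner ℝ η (T x))) ref
  integral_exp_pos : ∀ η ∈ Ψ, 0 < ∫ x, h x * Real.exp (inner ℝ η (T x)) ∂ref

namespace ExpFamily

variable {𝓧 : Type*} [MeasurableSpace 𝓧]

/-- The log-partition function. -/
noncomputable def logPartition (F : ExpFamily 𝓧) (η : EuclideanSpace ℝ (Fin F.dim)) : ℝ :=
  Real.log (∫ x, F.h x * Real.exp (inner ℝ η (F.T x)) ∂F.ref)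

/-- The density `f(x | η)`. -/
noncomputable def density (F : ExpFamily 𝓧) (η : EuclideanSpace ℝ (Fin F.dim)) (x : 𝓧) : ℝ :=
  F.h x * Real.exp (inner ℝ η (F.T x) - F.logPartition η)

/-- The distribution of an observation when the natural parameter is `η`. -/
noncomputable def law (F : ExpFamily 𝓧) (η : F.Ψ) : Measure 𝓧 :=
  F.ref.withDensity (fun x => ENNReal.ofReal (F.density η.1 x))

instance isProbabilityMeasure_law (F : ExpFamily 𝓧) (η : F.Ψ) :
    IsProbabilityMeasure (F.law η) := by
  have hpos := F.integral_exp_pos η.1 η.2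
  have hint := F.integrable_exp η.1 η.2
  have hd : ∀ x, F.density η.1 x =
      (F.h x * Real.exp (inner ℝ η.1 (F.T x))) *
        (∫ x, F.h x * Real.exp (inner ℝ η.1 (F.T x)) ∂F.ref)⁻¹ := by
    intro x
    rw [density, logPartition, Real.exp_sub, Real.exp_log hpos]
    ring
  constructor
  rw [law, withDensity_apply _ MeasurableSet.univ, Measure.restrict_univ,
    ← ofReal_integral_eq_lintegral_ofReal]
  · simp_rw [hd]
    rw [integral_mul_const, mul_inv_cancel₀ hpos.ne', ENNReal.ofReal_one]
  · rw [show F.density η.1 = _ from funext hd]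
    exact hint.mul_const _
  · exact Filter.Eventually.of_forall
      (fun x => mul_nonneg (F.h_nonneg x) (Real.exp_pos _).le)

/-- The relative entropy `D(η ‖ η')` of two members of the family. -/
noncomputable def relEntropy (F : ExpFamily 𝓧) (η η' : F.Ψ) : ℝ≥0∞ :=
  InformationTheory.klDiv (F.law η) (F.law η')

end ExpFamily

/-! ### Parameters and the information constant -/

section Parameters

variable {K M : ℕ} {𝓧 : Type*} [MeasurableSpace 𝓧]

/-- The parameter space `Ω = Ψ₁ × ⋯ × Ψ_K`; arm `i` has its own exponential family `F i`. -/
abbrev Param (F : Fin K → ExpFamily 𝓧) : Type := (i : Fin K) → (F i).Ψ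

/-- `Θ_{-l}`: the union of all the `Θ m`, without `Θ l`. -/
def alternatives {F : Fin K → ExpFamily 𝓧} (Θ : Fin M → Set (Param F)) (l : Fin M) :
    Set (Param F) :=
  (⋃ m, Θ m) \ Θ l

/-- `D*(η) = sup_λ inf_{η' ∈ Θ_{-l}} ∑ i, λ i * D(η i ‖ η' i)`, with `λ` ranging over the
probability distributions on the set of arms; the infimum over the empty set is `∞`. -/
noncomputable def Dstar {F : Fin K → ExpFamily 𝓧} (Θ : Fin M → Set (Param F)) (l : Fin M)
    (η : Param F) : ℝ≥0∞ :=
  ⨆ w ∈ stdSimplex ℝ (Fin K), ⨅ η' ∈ alternatives Θ l,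
    ∑ i, ENNReal.ofReal (w i) * (F i).relEntropy (η i) (η' i)

end Parameters

/-- Relative entropy of the Bernoulli distributions with success probabilities `p` and `q`. -/
noncomputable def binaryRelEntropy (p q : ℝ) : ℝ :=
  p * Real.log (p / q) + (1 - p) * Real.log ((1 - p) / (1 - q))

/-! ### Policies and the law of the observed process -/

/-- What the decision maker does at a stage: stop and declare a hypothesis (`inl`), or continue and
pull an arm (`inr`). -/
abbrev Action (K M : ℕ) : Type := Fin M ⊕ Fin K

/-- The record of a stage: `inl δ` if the decision maker stopped and declared `δ`, `inr (a, x)` if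
arm `a` was pulled and `x` was observed. -/
abbrev Outcome (K M : ℕ) (𝓧 : Type*) : Type _ := Fin M ⊕ (Fin K × 𝓧)

/-- The trajectories of the process; the coordinate `n` is the record of stage `n + 1`. -/
abbrev Trajectory (K M : ℕ) (𝓧 : Type*) : Type _ := ℕ → Outcome K M 𝓧

/-- A policy: at every stage, a probability distribution over the actions (stop with a decision, or
continue with an arm), as a measurable function of the past actions and observations.  The policies
that decide deterministically between `(stop, δ)` and `(continue, λ)` are those for which this
distribution is either `dirac (inl δ)` or `λ` on the arms; internal randomisation is allowed too.
The process is only looked at until the first stop, so what a policy does with a past that contains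
a stop does not matter. -/
structure Policy (K M : ℕ) (𝓧 : Type*) [MeasurableSpace 𝓧] where
  /-- the distribution of the action at the first stage, where there is no past -/
  init : Measure (Action K M)
  isProbabilityMeasure_init : IsProbabilityMeasure init
  /-- the distribution of the action at stage `n + 2`, given the records of the stages
  `1, …, n + 1` -/
  next : (n : ℕ) → Kernel ((i : Finset.Iic n) → Outcome K M 𝓧) (Action K M)
  isMarkovKernel_next : ∀ n, IsMarkovKernel (next n)

section Laws

variable {K M : ℕ} {𝓧 : Type*} [MeasurableSpace 𝓧]

instance (π : Policy K M 𝓧) : IsProbabilityMeasure π.init := π.isProbabilityMeasure_init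

instance (π : Policy K M 𝓧) (n : ℕ) : IsMarkovKernel (π.next n) := π.isMarkovKernel_next n

/-- The record of a stage given the action: a stop is just recorded, and pulling arm `a` produces an
observation with the distribution of that arm. -/
noncomputable def observe {F : Fin K → ExpFamily 𝓧} (η : Param F) :
    Kernel (Action K M) (Outcome K M 𝓧) where
  toFun := Sum.elim (fun δ => Measure.dirac (Sum.inl δ))
    (fun a => ((F a).law (η a)).map (fun x => Sum.inr (a, x)))
  measurable' := measurable_fun_sum (measurable_of_countable _) (measurable_of_countable _)

instance {F : Fin K → ExpFamily 𝓧} (η : Param F) :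
    IsMarkovKernel (observe (M := M) η) := by
  constructor
  rintro (δ | a)
  · change IsProbabilityMeasure (Measure.dirac _)
    infer_instance
  · change IsProbabilityMeasure (((F a).law (η a)).map (fun x => Sum.inr (a, x)))
    exact Measure.isProbabilityMeasure_map (by fun_prop)

/-- The law `P( · | η)` of the process when policy `π` is used and the true parameter is `η`. -/
noncomputable def trajLaw {F : Fin K → ExpFamily 𝓧} (π : Policy K M 𝓧) (η : Param F) :
    Measure (Trajectory K M 𝓧) :=
  Kernel.trajMeasure (X := fun _ => Outcome K M 𝓧) (π.init.bind (observe η))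
    (fun n => observe η ∘ₖ π.next n)

/-- The stopping time `τ = inf {n ≥ 1 : stop at stage n}`, with value `∞` if there is no stop.  The
last observation before the stop is that of stage `τ - 1`. -/
noncomputable def stopTime (ω : Trajectory K M 𝓧) : ℝ≥0∞ :=
  ⨅ (n : ℕ) (_ : (ω n).isLeft = true), (n : ℝ≥0∞) + 1

open Classical in
/-- The decision `δ` declared at the stopping time; `none` if the policy never stops. -/
noncomputable def decision (ω : Trajectory K M 𝓧) : Option (Fin M) :=
  if H : ∃ n, (ω n).isLeft = true then (ω (Nat.find H)).getLeft? else none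

/-- The set `Π(α)` of admissible policies: the probability of a false detection `δ ≠ l` (which
includes never stopping) is at most `α` for all `η ∈ Θ l` and all `l`. -/
def admissible {F : Fin K → ExpFamily 𝓧} (Θ : Fin M → Set (Param F)) (α : ℝ) :
    Set (Policy K M 𝓧) :=
  {π | ∀ l, ∀ η ∈ Θ l, trajLaw π η {ω | decision ω ≠ some l} ≤ ENNReal.ofReal α}

/-- The switching cost between two consecutive stages; it is `0` unless an arm is pulled in both. -/
noncomputable def switchCost (g : Fin K → Fin K → ℝ≥0) :
    Outcome K M 𝓧 → Outcome K M 𝓧 → ℝ≥0∞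
  | Sum.inr (a, _), Sum.inr (a', _) => g a a'
  | _, _ => 0

open Classical in
/-- The total cost `C = τ + ∑_{1 ≤ k ≤ τ - 1} g(a_k, a_{k+1})`; the index `n` stands for
`k = n + 1`. -/
noncomputable def totalCost (g : Fin K → Fin K → ℝ≥0) (ω : Trajectory K M 𝓧) : ℝ≥0∞ :=
  stopTime ω +
    ∑' n : ℕ, if (n : ℝ≥0∞) + 2 ≤ stopTime ω then switchCost g (ω n) (ω (n + 1)) else 0

end Laws

end BanditTest

/-! The proof is a change of measure. Let `η' ∈ Θ m` with `m ≠ l`, let `Y` be the log-likelihood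
ratio of `η` against `η'` up to the stop or horizon `n`, and let `A` be the event that `l` is
declared by then. With `L = log ((1 - α) / α)`, the inequality `1 + u ≤ exp u` at `u = L - Y` on `A`
and at `u = -L - Y` off `A` is integrated under `η`. The exponentials become probabilities under
`η'`, where declaring `l` is an error and so `A` has probability at most `α`; what remains is `E[Y]
≥ 2 L P(A) - L`. As `n → ∞`, `P(A)` tends to at least `1 - α`, and the right side to at least `(1 -
2α) L = d_b(α‖1-α)` (`two_mul_measure_declaresBefore_le`, `binaryRelEntropy_le`).

By Wald's identity `E[Y]` is at most the sum over the arms of expected pulls times relative entropy.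
To allow infinite entropies, each increment `u` of `Y` is replaced by `u + exp (-u) - 1 ≥ 0`, whose
mean is exactly the relative entropy (`relEntropy_eq_lintegral`); the corrections have equal finite
means and cancel.

The expected pulls do not depend on `η'`. Divided by their sum, which is at most `E[τ - 1]`, they
are a competitor `λ` in `D*` (`div_iSup_iInf_le`). -/

namespace BanditTest

/-! ### Disintegration of the trajectory law, one stage at a time. -/

section TrajectoryLaw

variable {K M : ℕ} {𝓧 : Type*} [MeasurableSpace 𝓧]

/-- The distribution of the action at stage `k + 1` as a function of the whole trajectory, of which
only the first `k` coordinates matter. -/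
noncomputable def Policy.act (π : Policy K M 𝓧) : ℕ → Kernel (Trajectory K M 𝓧) (Action K M)
  | 0 => Kernel.const _ π.init
  | k + 1 => (π.next k).comap (Preorder.frestrictLe k) (by fun_prop)

instance (π : Policy K M 𝓧) (k : ℕ) : IsMarkovKernel (π.act k) := by
  cases k <;> (unfold Policy.act; infer_instance)

/-- `f` depends on the first `k` coordinates only. -/
def DependsOnFirst {β : Type*} (k : ℕ) (f : Trajectory K M 𝓧 → β) : Prop :=
  ∀ ⦃ω ω' : Trajectory K M 𝓧⦄, (∀ i < k, ω i = ω' i) → f ω = f ω'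

lemma Policy.act_congr (π : Policy K M 𝓧) (k : ℕ) : DependsOnFirst k (fun ω => π.act k ω) := by
  intro ω ω' h
  cases k with
  | zero => rfl
  | succ k =>
    simp only [Policy.act, Kernel.comap_apply]
    congr 1
    ext i
    exact h i (Nat.lt_succ_of_le (Finset.mem_Iic.1 i.2))

variable {F : Fin K → ExpFamily 𝓧}

instance (π : Policy K M 𝓧) (η : Param F) : IsProbabilityMeasure (trajLaw π η) := by
  unfold trajLaw; infer_instance

lemma trajMeasure_map_eval_zero {X : ℕ → Type*} [∀ n, MeasurableSpace (X n)]
    (μ₀ : Measure (X 0)) [IsProbabilityMeasure μ₀]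
    (κ : (n : ℕ) → Kernel ((i : Finset.Iic n) → X i) (X (n + 1))) [∀ n, IsMarkovKernel (κ n)] :
    (Kernel.trajMeasure μ₀ κ).map (fun x => x 0) = μ₀ := by
  have h : (fun x : (n : ℕ) → X n => x 0) =
      (fun y : (i : Finset.Iic 0) → X i => y ⟨0, by simp⟩) ∘ Preorder.frestrictLe 0 := rfl
  rw [h, ← Measure.map_map (by fun_prop) (by fun_prop), Kernel.trajMeasure,
    Measure.map_comp _ _ (by fun_prop), Kernel.traj_map_frestrictLe, Kernel.partialTraj_self,
    Measure.id_comp]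
  exact (Measure.map_map (by fun_prop) (MeasurableEquiv.measurable _)).trans Measure.map_id

/-- Conditioning on the first `k` stages: the next record is drawn by choosing an action according
to the policy and then observing. -/
lemma lintegral_trajLaw_succ (π : Policy K M 𝓧) (η : Param F) (k : ℕ)
    {f : Trajectory K M 𝓧 → ℝ≥0∞} (hf : Measurable f) (hfd : DependsOnFirst (k + 1) f) :
    ∫⁻ ω, f ω ∂(trajLaw π η) =
      ∫⁻ ω, ∫⁻ b, ∫⁻ y, f (Function.update ω k y) ∂(observe η b) ∂(π.act k ω) ∂(trajLaw π η) := by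
  cases k with
  | zero =>
    -- Only coordinate `0` matters, so a constant path serves as representative.
    have h1 : ∀ ω, f ω = f (fun _ => ω 0) := fun ω => hfd (by simp)
    have h2 : ∀ ω y, f (Function.update ω 0 y) = f (fun _ => y) := fun ω y => hfd (by simp)
    have hm : Measurable (fun y : Outcome K M 𝓧 => f (fun _ => y)) := hf.comp (by fun_prop)
    simp_rw [h2]
    simp only [Policy.act, Kernel.const_apply, lintegral_const, measure_univ, mul_one]
    rw [lintegral_congr h1, ← lintegral_map (μ := trajLaw π η)
      (f := fun y : Outcome K M 𝓧 => f (fun _ => y)) (g := fun ω => ω 0) hm (by fun_prop),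
      trajLaw, trajMeasure_map_eval_zero (X := fun _ => Outcome K M 𝓧),
      Measure.lintegral_bind (by fun_prop) hm.aemeasurable]
  | succ k =>
    -- `e` glues a past and a next record into a path; its values beyond coordinate `k + 1` are
    -- irrelevant to `f`.
    let e : ((i : Finset.Iic k) → Outcome K M 𝓧) × Outcome K M 𝓧 → Trajectory K M 𝓧 :=
      fun p i => if h : i ≤ k then p.1 ⟨i, Finset.mem_Iic.2 h⟩ else p.2
    have he : Measurable e := by
      refine measurable_pi_lambda _ fun i => ?_
      by_cases h : i ≤ k
      · simp only [e, h, dite_true]; fun_prop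
      · simp only [e, h, dite_false]; fun_prop
    have h1 : ∀ ω, f ω = f (e (Preorder.frestrictLe k ω, ω (k + 1))) := by
      intro ω
      refine hfd fun i hi => ?_
      by_cases h : i ≤ k
      · simp [e, h]
      · obtain rfl : i = k + 1 := by omega
        simp [e]
    have h2 : ∀ ω y, f (Function.update ω (k + 1) y) = f (e (Preorder.frestrictLe k ω, y)) := by
      intro ω y
      refine hfd fun i hi => ?_
      by_cases h : i ≤ k
      · rw [Function.update_of_ne (by omega)]; simp [e, h]
      · obtain rfl : i = k + 1 := by omega
        simp [e]
    have hm : Measurable (fun p => f (e p)) := hf.comp he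
    simp_rw [h2]
    rw [lintegral_congr h1, ← lintegral_map (μ := trajLaw π η)
      (g := fun ω => (Preorder.frestrictLe k ω, ω (k + 1))) hm (by fun_prop), trajLaw,
      ← Kernel.map_frestrictLe_trajMeasure_compProd_eq_map_trajMeasure
        (X := fun _ => Outcome K M 𝓧),
      Measure.lintegral_compProd hm,
      lintegral_map (Measurable.lintegral_kernel_prod_right' hm) (by fun_prop)]
    refine lintegral_congr fun ω => ?_
    rw [Kernel.lintegral_comp _ _ _ (by fun_prop)]
    rfl

end TrajectoryLaw

/-! ### Likelihood ratios and relative entropy within one exponential family. -/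

namespace ExpFamily

variable {𝓧 : Type*} [MeasurableSpace 𝓧]

/-- The log-likelihood ratio of two members of the family. -/
noncomputable def logRatio (F : ExpFamily 𝓧) (η η' : F.Ψ) (x : 𝓧) : ℝ :=
  inner ℝ (η.1 - η'.1) (F.T x) - (F.logPartition η.1 - F.logPartition η'.1)

@[fun_prop]
lemma measurable_logRatio (F : ExpFamily 𝓧) (η η' : F.Ψ) : Measurable (F.logRatio η η') := by
  have := F.measurable_T
  unfold logRatio
  fun_prop

lemma measurable_density (F : ExpFamily 𝓧) (η : EuclideanSpace ℝ (Fin F.dim)) :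
    Measurable (F.density η) := by
  have := F.measurable_T
  have := F.measurable_h
  unfold density
  fun_prop

lemma logRatio_symm (F : ExpFamily 𝓧) (η η' : F.Ψ) (x : 𝓧) :
    F.logRatio η η' x = -F.logRatio η' η x := by
  simp only [logRatio, inner_sub_left]; ring

/-- The carrier `h` is common to both densities, so the ratio is a positive exponential and all
members of the family are mutually absolutely continuous. -/
lemma law_eq_withDensity (F : ExpFamily 𝓧) (η η' : F.Ψ) :
    F.law η' = (F.law η).withDensity (fun x => ENNReal.ofReal (Real.exp (-F.logRatio η η' x))) := by
  rw [law, law, ← withDensity_mul _ (F.measurable_density _).ennreal_ofReal (by fun_prop)]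
  congr 1
  ext x
  rw [Pi.mul_apply, density, density, ← ENNReal.ofReal_mul
    (mul_nonneg (F.h_nonneg x) (Real.exp_pos _).le), mul_assoc, ← Real.exp_add]
  simp only [logRatio, inner_sub_left]
  ring_nf

lemma lintegral_law (F : ExpFamily 𝓧) (η η' : F.Ψ) {f : 𝓧 → ℝ≥0∞} (hf : Measurable f) :
    ∫⁻ x, f x ∂(F.law η') =
      ∫⁻ x, ENNReal.ofReal (Real.exp (-F.logRatio η η' x)) * f x ∂(F.law η) := by
  rw [F.law_eq_withDensity η η', lintegral_withDensity_eq_lintegral_mul _ (by fun_prop) hf]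
  rfl

/-- With `r = exp u` the density of `η` against `η'`, the integrand `r log r + 1 - r` under `η'`
becomes `u + exp (-u) - 1` under `η`. It is nonnegative, so no integrability of `u` is needed and
the value `∞` is allowed. -/
lemma relEntropy_eq_lintegral (F : ExpFamily 𝓧) (η η' : F.Ψ) :
    F.relEntropy η η' = ∫⁻ x, ENNReal.ofReal
      (F.logRatio η η' x + Real.exp (-F.logRatio η η' x) - 1) ∂(F.law η) := by
  have hd := F.law_eq_withDensity η' η
  have hac : F.law η ≪ F.law η' := hd ▸ withDensity_absolutelyContinuous _ _
  have hrn : (F.law η).rnDeriv (F.law η') =ᵐ[F.law η']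
      fun x => ENNReal.ofReal (Real.exp (F.logRatio η η' x)) := by
    simp only [F.logRatio_symm η η']
    conv_lhs => rw [hd]
    exact Measure.rnDeriv_withDensity _ (by fun_prop)
  rw [relEntropy, InformationTheory.klDiv_eq_lintegral_klFun_of_ac hac]
  have h1 : ∫⁻ x, ENNReal.ofReal
        (InformationTheory.klFun ((F.law η).rnDeriv (F.law η') x).toReal) ∂(F.law η') =
      ∫⁻ x, ENNReal.ofReal
        (InformationTheory.klFun (Real.exp (F.logRatio η η' x))) ∂(F.law η') := by
    refine lintegral_congr_ae ?_
    filter_upwards [hrn] with x hx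
    rw [hx, ENNReal.toReal_ofReal (Real.exp_pos _).le]
  rw [h1, F.lintegral_law η η' (by fun_prop)]
  refine lintegral_congr fun x => ?_
  rw [← ENNReal.ofReal_mul (Real.exp_pos _).le, InformationTheory.klFun, Real.log_exp]
  congr 1
  have : Real.exp (-F.logRatio η η' x) * Real.exp (F.logRatio η η' x) = 1 := by
    rw [← Real.exp_add]; simp
  linear_combination (F.logRatio η η' x - 1) * this

end ExpFamily

/-! ### Likelihood ratios of records, and change of measure over finitely many stages. -/

section Ratio

variable {K M : ℕ} {𝓧 : Type*} [MeasurableSpace 𝓧] {F : Fin K → ExpFamily 𝓧}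

/-- The log-likelihood ratio of the record of a stage, given the action. -/
noncomputable def outcomeLogRatio (η η' : Param F) : Outcome K M 𝓧 → ℝ :=
  Sum.elim (fun _ => 0) (fun p => (F p.1).logRatio (η p.1) (η' p.1) p.2)

/-- The relative entropy of the arm pulled at a stage; `0` for a stop. -/
noncomputable def outcomeEntropy (η η' : Param F) : Outcome K M 𝓧 → ℝ≥0∞ :=
  Sum.elim (fun _ => 0) (fun p => (F p.1).relEntropy (η p.1) (η' p.1))

@[fun_prop]
lemma measurable_outcomeLogRatio (η η' : Param F) :
    Measurable (outcomeLogRatio (M := M) η η') :=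
  measurable_const.sumElim
    (measurable_from_prod_countable_right fun a => (F a).measurable_logRatio (η a) (η' a))

@[fun_prop]
lemma measurable_outcomeEntropy (η η' : Param F) :
    Measurable (outcomeEntropy (M := M) η η') :=
  measurable_const.sumElim
    (measurable_from_prod_countable_right fun a =>
      (measurable_const : Measurable fun _ : 𝓧 => (F a).relEntropy (η a) (η' a)))

lemma lintegral_observe_inl (η : Param F) (δ : Fin M) {f : Outcome K M 𝓧 → ℝ≥0∞}
    (hf : Measurable f) : ∫⁻ y, f y ∂(observe η (Sum.inl δ)) = f (Sum.inl δ) :=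
  lintegral_dirac' _ hf

lemma lintegral_observe_inr (η : Param F) (a : Fin K) {f : Outcome K M 𝓧 → ℝ≥0∞}
    (hf : Measurable f) :
    ∫⁻ y, f y ∂(observe η (Sum.inr a)) = ∫⁻ x, f (Sum.inr (a, x)) ∂((F a).law (η a)) :=
  lintegral_map hf (by fun_prop)

lemma lintegral_observe_change (η η' : Param F) (b : Action K M) {f : Outcome K M 𝓧 → ℝ≥0∞}
    (hf : Measurable f) :
    ∫⁻ y, f y ∂(observe η' b) =
      ∫⁻ y, ENNReal.ofReal (Real.exp (-outcomeLogRatio η η' y)) * f y ∂(observe η b) := by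
  rcases b with δ | a
  · rw [lintegral_observe_inl _ _ hf, lintegral_observe_inl _ _ (by fun_prop)]
    simp [outcomeLogRatio]
  · rw [lintegral_observe_inr _ _ hf, lintegral_observe_inr _ _ (by fun_prop),
      (F a).lintegral_law (η a) (η' a) (by fun_prop)]
    rfl

lemma lintegral_observe_entropy (η η' : Param F) (b : Action K M) :
    ∫⁻ y, ENNReal.ofReal (outcomeLogRatio η η' y + Real.exp (-outcomeLogRatio η η' y) - 1)
        ∂(observe η b) =
      ∫⁻ y, outcomeEntropy η η' y ∂(observe η b) := by
  rcases b with δ | a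
  · rw [lintegral_observe_inl _ _ (by fun_prop), lintegral_observe_inl _ _ (by fun_prop)]
    simp [outcomeLogRatio, outcomeEntropy]
  · rw [lintegral_observe_inr _ _ (by fun_prop), lintegral_observe_inr _ _ (by fun_prop)]
    simp only [outcomeLogRatio, outcomeEntropy, Sum.elim_inr, lintegral_const, measure_univ,
      mul_one]
    exact ((F a).relEntropy_eq_lintegral _ _).symm

/-- Two functions of the record of stage `k + 1` with the same mean given the action can be
exchanged under the law of the process. -/
lemma lintegral_trajLaw_mul_congr (π : Policy K M 𝓧) (η : Param F) (k : ℕ)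
    {f : Trajectory K M 𝓧 → ℝ≥0∞} (hf : Measurable f) (hfd : DependsOnFirst k f)
    {ψ ψ' : Outcome K M 𝓧 → ℝ≥0∞} (hψ : Measurable ψ) (hψ' : Measurable ψ')
    (h : ∀ b, ∫⁻ y, ψ y ∂(observe η b) = ∫⁻ y, ψ' y ∂(observe η b)) :
    ∫⁻ ω, f ω * ψ (ω k) ∂(trajLaw π η) = ∫⁻ ω, f ω * ψ' (ω k) ∂(trajLaw π η) := by
  have key : ∀ {ψ : Outcome K M 𝓧 → ℝ≥0∞}, Measurable ψ →
      ∫⁻ ω, f ω * ψ (ω k) ∂(trajLaw π η) =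
        ∫⁻ ω, ∫⁻ b, f ω * ∫⁻ y, ψ y ∂(observe η b) ∂(π.act k ω) ∂(trajLaw π η) := by
    intro ψ hψ
    rw [lintegral_trajLaw_succ π η k (by fun_prop)]
    · refine lintegral_congr fun ω => lintegral_congr fun b => ?_
      rw [← lintegral_const_mul _ hψ]
      refine lintegral_congr fun y => ?_
      rw [Function.update_self]
      congr 1
      exact hfd fun i hi => Function.update_of_ne hi.ne _ _
    · intro ω ω' h
      simp only
      rw [hfd fun i hi => h i (by omega), h k (by omega)]
  rw [key hψ, key hψ']
  simp_rw [h]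

/-- Change of measure for the first `k` stages. -/
lemma lintegral_trajLaw_change (π : Policy K M 𝓧) (η η' : Param F) (k : ℕ) :
    ∀ {f : Trajectory K M 𝓧 → ℝ≥0∞}, Measurable f → DependsOnFirst k f →
    ∫⁻ ω, f ω ∂(trajLaw π η') =
      ∫⁻ ω, (∏ t ∈ Finset.range k, ENNReal.ofReal (Real.exp (-outcomeLogRatio η η' (ω t)))) * f ω
        ∂(trajLaw π η) := by
  induction k with
  | zero =>
    intro f hf hfd
    obtain ⟨ω₀⟩ : Nonempty (Trajectory K M 𝓧) := (trajLaw π η).nonempty_of_neZero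
    have : ∀ ω, f ω = f ω₀ := fun ω => hfd (by simp)
    simp [this]
  | succ k ih =>
    intro f hf hfd
    have hm : Measurable fun p : Trajectory K M 𝓧 × Outcome K M 𝓧 =>
        f (Function.update p.1 k p.2) := hf.comp measurable_update'
    have hg : Measurable fun p : Trajectory K M 𝓧 × Action K M =>
        ∫⁻ y, f (Function.update p.1 k y) ∂(observe η' p.2) :=
      Measurable.lintegral_kernel_prod_right' (κ := (observe η').comap Prod.snd measurable_snd)
        (f := fun p : (Trajectory K M 𝓧 × Action K M) × Outcome K M 𝓧 =>
          f (Function.update p.1.1 k p.2))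
        (hm.comp ((measurable_fst.comp measurable_fst).prodMk measurable_snd))
    have hG : Measurable fun ω : Trajectory K M 𝓧 =>
        ∫⁻ b, ∫⁻ y, f (Function.update ω k y) ∂(observe η' b) ∂(π.act k ω) :=
      Measurable.lintegral_kernel_prod_right' hg
    -- The last record is integrated out under `η'`, and the induction hypothesis applies to that
    -- conditional mean. The action kernel is the same under both parameters, so only `observe`
    -- contributes a factor.
    rw [lintegral_trajLaw_succ π η' k hf hfd, ih hG, lintegral_trajLaw_succ π η k
      (f := fun ω => (∏ t ∈ Finset.range (k + 1),
        ENNReal.ofReal (Real.exp (-outcomeLogRatio η η' (ω t)))) * f ω)]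
    · refine lintegral_congr fun ω => ?_
      have hgω : Measurable fun b => ∫⁻ y, f (Function.update ω k y) ∂(observe η' b) :=
        hg.comp measurable_prodMk_left
      rw [← lintegral_const_mul _ hgω]
      refine lintegral_congr fun b => ?_
      have hmω : Measurable fun y => f (Function.update ω k y) := hm.comp measurable_prodMk_left
      rw [lintegral_observe_change η η' b hmω, ← lintegral_const_mul _ (by fun_prop)]
      refine lintegral_congr fun y => ?_
      rw [Finset.prod_range_succ, Function.update_self, mul_assoc]
      congr 1
      refine Finset.prod_congr rfl fun t ht => ?_
      rw [Function.update_of_ne (Finset.mem_range.1 ht).ne]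
    · fun_prop
    · intro ω ω' h
      simp only
      rw [hfd h]
      congr 1
      refine Finset.prod_congr rfl fun t ht => ?_
      rw [h t (Finset.mem_range.1 ht)]
    · intro ω ω' h
      simp only
      rw [show π.act k ω = π.act k ω' from π.act_congr k h]
      refine lintegral_congr fun b => lintegral_congr fun y => hfd fun i hi => ?_
      rcases eq_or_ne i k with rfl | hik
      · simp
      · rw [Function.update_of_ne hik, Function.update_of_ne hik, h i (by omega)]

end Ratio

/-! ### The stopped likelihood ratio and the information inequality. -/

section Stopping

variable {K M : ℕ} {𝓧 : Type*}

/-- The event that the process does not stop at the stages `1, …, k`. -/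
def running (k : ℕ) : Set (Trajectory K M 𝓧) := {ω | ∀ t < k, (ω t).isLeft = false}

/-- The event that the process stops at stage `k + 1` and declares `l`. -/
def declaresAt (l : Fin M) (k : ℕ) : Set (Trajectory K M 𝓧) :=
  running k ∩ {ω | ω k = Sum.inl l}

/-- The event that the process declares `l` at one of the stages `1, …, n`. -/
def declaresBefore (l : Fin M) (n : ℕ) : Set (Trajectory K M 𝓧) :=
  ⋃ k ∈ Finset.range n, declaresAt l k

/-- The indicator of `running k`. -/
noncomputable def alive (k : ℕ) : Trajectory K M 𝓧 → ℝ := (running k).indicator 1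

lemma running_congr {k : ℕ} {ω ω' : Trajectory K M 𝓧} (h : ∀ i < k, ω i = ω' i) :
    ω ∈ running k ↔ ω' ∈ running k :=
  forall₂_congr fun t ht => by rw [h t ht]

lemma alive_nonneg (k : ℕ) (ω : Trajectory K M 𝓧) : 0 ≤ alive k ω :=
  Set.indicator_nonneg (fun _ _ => zero_le_one) ω

lemma alive_of_mem {k : ℕ} {ω : Trajectory K M 𝓧} (h : ω ∈ running k) : alive k ω = 1 :=
  Set.indicator_of_mem h _

lemma alive_of_notMem {k : ℕ} {ω : Trajectory K M 𝓧} (h : ω ∉ running k) : alive k ω = 0 :=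
  Set.indicator_of_notMem h _

lemma alive_le_one (k : ℕ) (ω : Trajectory K M 𝓧) : alive k ω ≤ 1 := by
  by_cases h : ω ∈ running k
  · rw [alive_of_mem h]
  · rw [alive_of_notMem h]; exact zero_le_one

lemma alive_congr (k : ℕ) : DependsOnFirst k (alive (K := K) (M := M) (𝓧 := 𝓧) k) := by
  intro ω ω' h
  by_cases hω : ω ∈ running k
  · rw [alive_of_mem hω, alive_of_mem ((running_congr h).1 hω)]
  · rw [alive_of_notMem hω, alive_of_notMem (mt (running_congr h).2 hω)]

lemma running_anti {j k : ℕ} (h : j ≤ k) {ω : Trajectory K M 𝓧} (hω : ω ∈ running k) :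
    ω ∈ running j :=
  fun t ht => hω t (ht.trans_le h)

lemma notMem_running_of_declaresAt {l : Fin M} {k t : ℕ} (h : k < t) {ω : Trajectory K M 𝓧}
    (hω : ω ∈ declaresAt l k) : ω ∉ running t := by
  intro hr
  have := hr k h
  rw [show ω k = Sum.inl l from hω.2] at this
  simp at this

lemma pairwise_disjoint_declaresAt (l : Fin M) :
    Pairwise (Function.onFun Disjoint (declaresAt (K := K) (𝓧 := 𝓧) l)) := by
  intro j k hjk
  refine Set.disjoint_left.2 fun ω hj hk => ?_
  rcases hjk.lt_or_gt with h | h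
  · exact notMem_running_of_declaresAt h hj hk.1
  · exact notMem_running_of_declaresAt h hk hj.1

lemma declaresBefore_mono (l : Fin M) : Monotone (declaresBefore (K := K) (𝓧 := 𝓧) l) :=
  fun _ _ h => Set.biUnion_subset_biUnion_left
    (Finset.coe_subset.2 (Finset.range_subset_range.2 h))

lemma setOf_decision_eq (l : Fin M) :
    {ω : Trajectory K M 𝓧 | decision ω = some l} = ⋃ n, declaresBefore l n := by
  classical
  have h1 : ⋃ n, declaresBefore (K := K) (𝓧 := 𝓧) l n = ⋃ k, declaresAt l k := by
    ext ω
    simp only [declaresBefore, Set.mem_iUnion, Finset.mem_range, exists_prop]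
    exact ⟨fun ⟨_, k, _, h⟩ => ⟨k, h⟩, fun ⟨k, h⟩ => ⟨k + 1, k, k.lt_succ_self, h⟩⟩
  rw [h1]
  ext ω
  simp only [Set.mem_ofPred_eq, Set.mem_iUnion, decision]
  constructor
  · intro h
    split_ifs at h with H
    refine ⟨Nat.find H, fun t ht => ?_, ?_⟩
    · simpa using Nat.find_min H ht
    · exact Sum.getLeft?_eq_some_iff.1 h
  · rintro ⟨k, hr, hk⟩
    have hk' : ω k = Sum.inl l := hk
    have H : ∃ n, (ω n).isLeft = true := ⟨k, by simp [hk']⟩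
    have hf : Nat.find H = k := by
      rw [Nat.find_eq_iff]
      refine ⟨by simp [hk'], fun t ht => ?_⟩
      simp [hr t ht]
    rw [dif_pos H, hf, hk', Sum.getLeft?_inl]

variable [MeasurableSpace 𝓧]

lemma measurableSet_running (k : ℕ) : MeasurableSet (running (K := K) (M := M) (𝓧 := 𝓧) k) := by
  have hm : Measurable (fun y : Outcome K M 𝓧 => y.isLeft) :=
    measurable_fun_sum (measurable_const (a := true)) (measurable_const (a := false))
  have : running (K := K) (M := M) (𝓧 := 𝓧) k = ⋂ t, ⋂ (_ : t < k), {ω | (ω t).isLeft = false} := by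
    ext ω; simp [running]
  rw [this]
  refine MeasurableSet.iInter fun t => MeasurableSet.iInter fun _ => ?_
  exact (hm.comp (measurable_pi_apply t)) (measurableSet_singleton false)

lemma measurableSet_declaresAt (l : Fin M) (k : ℕ) :
    MeasurableSet (declaresAt (K := K) (𝓧 := 𝓧) l k) := by
  have hs : MeasurableSet ({Sum.inl l} : Set (Outcome K M 𝓧)) := by
    rw [← Set.image_singleton]
    exact (measurableSet_singleton l).inl_image
  exact (measurableSet_running k).inter (hs.preimage (measurable_pi_apply k))

lemma measurableSet_declaresBefore (l : Fin M) (n : ℕ) :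
    MeasurableSet (declaresBefore (K := K) (𝓧 := 𝓧) l n) :=
  Finset.measurableSet_biUnion _ fun k _ => measurableSet_declaresAt l k

@[fun_prop]
lemma measurable_alive (k : ℕ) : Measurable (alive (K := K) (M := M) (𝓧 := 𝓧) k) :=
  measurable_one.indicator (measurableSet_running k)

variable {F : Fin K → ExpFamily 𝓧}

/-- The log-likelihood ratio of the records up to the stop, and up to stage `n` at most. -/
noncomputable def stoppedLogRatio (η η' : Param F) (n : ℕ) (ω : Trajectory K M 𝓧) : ℝ :=
  ∑ t ∈ Finset.range n, alive t ω * outcomeLogRatio η η' (ω t)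

@[fun_prop]
lemma measurable_stoppedLogRatio (η η' : Param F) (n : ℕ) :
    Measurable (stoppedLogRatio (M := M) η η' n) := by
  unfold stoppedLogRatio; fun_prop

lemma stoppedLogRatio_congr (η η' : Param F) (n : ℕ) :
    DependsOnFirst n (stoppedLogRatio (M := M) η η' n) := by
  intro ω ω' h
  refine Finset.sum_congr rfl fun t ht => ?_
  have ht := Finset.mem_range.1 ht
  rw [h t ht, alive_congr t fun i hi => h i (hi.trans ht)]

/-- The likelihood ratio of the next record has conditional mean one. -/
lemma lintegral_mul_outcomeRatio (π : Policy K M 𝓧) (η η' : Param F) (k : ℕ)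
    {f : Trajectory K M 𝓧 → ℝ≥0∞} (hf : Measurable f) (hfd : DependsOnFirst k f) :
    ∫⁻ ω, f ω * ENNReal.ofReal (Real.exp (-outcomeLogRatio η η' (ω k))) ∂(trajLaw π η) =
      ∫⁻ ω, f ω ∂(trajLaw π η) := by
  rw [lintegral_trajLaw_mul_congr π η k hf hfd
    (ψ := fun y => ENNReal.ofReal (Real.exp (-outcomeLogRatio η η' y)))
    (by fun_prop) (measurable_const (a := 1))]
  · simp
  · intro b
    have := lintegral_observe_change η η' b (measurable_const (a := 1))
    simpa using this.symm

/-- A stopped likelihood ratio is a martingale started at `1`: it gains a factor of conditional mean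
one while running, and is frozen after the stop. -/
lemma lintegral_stoppedRatio (π : Policy K M 𝓧) (η η' : Param F) (n : ℕ) :
    ∫⁻ ω, ENNReal.ofReal (Real.exp (-stoppedLogRatio η η' n ω)) ∂(trajLaw π η) = 1 := by
  induction n with
  | zero => simp [stoppedLogRatio]
  | succ n ih =>
    set Z : Trajectory K M 𝓧 → ℝ≥0∞ :=
      fun ω => ENNReal.ofReal (Real.exp (-stoppedLogRatio η η' n ω)) with hZ
    have hZm : Measurable Z := by fun_prop
    have hr := measurableSet_running (K := K) (M := M) (𝓧 := 𝓧) n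
    have h1 : ∀ ω, ENNReal.ofReal (Real.exp (-stoppedLogRatio η η' (n + 1) ω)) =
        (running n).indicator Z ω * ENNReal.ofReal (Real.exp (-outcomeLogRatio η η' (ω n))) +
          (running n)ᶜ.indicator Z ω := by
      intro ω
      have hs : stoppedLogRatio η η' (n + 1) ω =
        stoppedLogRatio η η' n ω + alive n ω * outcomeLogRatio η η' (ω n) :=
          Finset.sum_range_succ _ _
      by_cases h : ω ∈ running n
      · rw [Set.indicator_of_mem h, Set.indicator_of_notMem (by simpa using h), add_zero, hs,
          alive_of_mem h, hZ, ← ENNReal.ofReal_mul (Real.exp_pos _).le, ← Real.exp_add]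
        ring_nf
      · rw [Set.indicator_of_notMem h, Set.indicator_of_mem (by simpa using h), hs,
          alive_of_notMem h, hZ]
        simp
    rw [lintegral_congr h1, lintegral_add_right _ (hZm.indicator hr.compl),
      lintegral_mul_outcomeRatio π η η' n (hZm.indicator hr), ← lintegral_add_right _
        (hZm.indicator hr.compl)]
    · rw [← ih]
      refine lintegral_congr fun ω => ?_
      exact congrFun (Set.indicator_self_add_compl (running n) Z) ω
    · intro ω ω' h
      have : Z ω = Z ω' := by rw [hZ]; simp only [stoppedLogRatio_congr η η' n h]
      by_cases hω : ω ∈ running n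
      · rw [Set.indicator_of_mem hω, Set.indicator_of_mem ((running_congr h).1 hω), this]
      · rw [Set.indicator_of_notMem hω, Set.indicator_of_notMem (mt (running_congr h).2 hω)]

lemma setLIntegral_stoppedRatio_declaresAt (π : Policy K M 𝓧) (η η' : Param F) (l : Fin M)
    {k n : ℕ} (hkn : k < n) :
    ∫⁻ ω in declaresAt l k, ENNReal.ofReal (Real.exp (-stoppedLogRatio η η' n ω)) ∂(trajLaw π η) =
      trajLaw π η' (declaresAt l k) := by
  have hm := measurableSet_declaresAt (K := K) (𝓧 := 𝓧) l k
  rw [← lintegral_indicator_one hm, lintegral_trajLaw_change π η η' (k + 1)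
    (measurable_one.indicator hm), ← lintegral_indicator hm]
  · refine lintegral_congr fun ω => ?_
    by_cases h : ω ∈ declaresAt l k
    · rw [Set.indicator_of_mem h, Set.indicator_of_mem h, Pi.one_apply, mul_one,
        ← ENNReal.ofReal_prod_of_nonneg fun _ _ => (Real.exp_pos _).le, ← Real.exp_sum,
        Finset.sum_neg_distrib]
      congr 3
      -- On `declaresAt l k` the weight `alive t` is `1` for `t ≤ k` and `0` afterwards, so the
      -- stopped ratio is the full ratio of `k + 1` stages.
      rw [stoppedLogRatio, ← Finset.sum_subset (Finset.range_subset_range.2 hkn)]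
      · refine Finset.sum_congr rfl fun t ht => ?_
        rw [alive_of_mem (running_anti (Nat.lt_succ_iff.1 (Finset.mem_range.1 ht)) h.1), one_mul]
      · intro t _ ht
        rw [alive_of_notMem (notMem_running_of_declaresAt (by simpa using ht) h), zero_mul]
    · rw [Set.indicator_of_notMem h, Set.indicator_of_notMem h, mul_zero]
  · have aux : ∀ {ω ω' : Trajectory K M 𝓧}, (∀ i < k + 1, ω i = ω' i) →
        ω ∈ declaresAt l k → ω' ∈ declaresAt l k := fun {ω ω'} h hω =>
      ⟨(running_congr fun i hi => h i (by omega)).1 hω.1, by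
        have := hω.2
        rwa [Set.mem_ofPred_eq, ← h k (by omega)]⟩
    intro ω ω' h
    by_cases hω : ω ∈ declaresAt l k
    · rw [Set.indicator_of_mem hω, Set.indicator_of_mem (aux h hω)]
      rfl
    · rw [Set.indicator_of_notMem hω,
        Set.indicator_of_notMem (mt (aux fun i hi => (h i hi).symm) hω)]

/-- Change of measure on the event that `l` is declared before a given stage. -/
lemma setLIntegral_stoppedRatio_declaresBefore (π : Policy K M 𝓧) (η η' : Param F) (l : Fin M)
    (n : ℕ) :
    ∫⁻ ω in declaresBefore l n,
        ENNReal.ofReal (Real.exp (-stoppedLogRatio η η' n ω)) ∂(trajLaw π η) =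
      trajLaw π η' (declaresBefore l n) := by
  have hd := (pairwise_disjoint_declaresAt (K := K) (𝓧 := 𝓧) l).set_pairwise
    (Finset.range n : Set ℕ)
  have hm : ∀ k ∈ Finset.range n, MeasurableSet (declaresAt (K := K) (𝓧 := 𝓧) l k) :=
    fun k _ => measurableSet_declaresAt l k
  rw [declaresBefore, lintegral_biUnion_finset hd hm, measure_biUnion_finset hd hm]
  exact Finset.sum_congr rfl fun k hk =>
    setLIntegral_stoppedRatio_declaresAt π η η' l (Finset.mem_range.1 hk)

/-- The relative entropies of the arms pulled at the stages `1, …, n`, up to the stop, added up and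
averaged. -/
noncomputable def expectedInformation (π : Policy K M 𝓧) (η η' : Param F) (n : ℕ) : ℝ≥0∞ :=
  ∑ t ∈ Finset.range n,
    ∫⁻ ω, ENNReal.ofReal (alive t ω) * outcomeEntropy η η' (ω t) ∂(trajLaw π η)

lemma expectedInformation_eq (π : Policy K M 𝓧) (η η' : Param F) (n : ℕ) :
    expectedInformation π η η' n = ∑ t ∈ Finset.range n, ∫⁻ ω, ENNReal.ofReal (alive t ω) *
      ENNReal.ofReal (outcomeLogRatio η η' (ω t) + Real.exp (-outcomeLogRatio η η' (ω t)) - 1)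
        ∂(trajLaw π η) :=
  Finset.sum_congr rfl fun t _ => (lintegral_trajLaw_mul_congr π η t
    (f := fun ω => ENNReal.ofReal (alive t ω)) (by fun_prop)
    (fun ω ω' h => by simp only [alive_congr t h]) (by fun_prop)
    (by fun_prop) (lintegral_observe_entropy η η')).symm

/-- This is `1 + 2 L 1_A ≤ Y + exp (-L - Y) + (exp L - exp (-L)) 1_A exp (-Y) + L`, with the same
sum `S` added to both sides and `Y + S` split as `(Y + S - R) + R`. Every term is then nonnegative
and can be integrated in `ℝ≥0∞`. -/
lemma stoppedLogRatio_lower_bound (η η' : Param F) (l : Fin M) (n : ℕ) {L : ℝ} (hL : 0 ≤ L)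
    (ω : Trajectory K M 𝓧) :
    1 + (∑ t ∈ Finset.range n,
        ENNReal.ofReal (alive t ω) * ENNReal.ofReal (Real.exp (-outcomeLogRatio η η' (ω t)))) +
      ENNReal.ofReal (2 * L) * (declaresBefore l n).indicator 1 ω ≤
    (∑ t ∈ Finset.range n, ENNReal.ofReal (alive t ω) *
        ENNReal.ofReal (outcomeLogRatio η η' (ω t) + Real.exp (-outcomeLogRatio η η' (ω t)) - 1)) +
      (∑ t ∈ Finset.range n, ENNReal.ofReal (alive t ω)) +
      (ENNReal.ofReal (Real.exp (-L)) * ENNReal.ofReal (Real.exp (-stoppedLogRatio η η' n ω)) +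
        ENNReal.ofReal (Real.exp L - Real.exp (-L)) * (declaresBefore l n).indicator
          (fun ω => ENNReal.ofReal (Real.exp (-stoppedLogRatio η η' n ω))) ω) +
      ENNReal.ofReal L := by
  set S := ∑ t ∈ Finset.range n, alive t ω * Real.exp (-outcomeLogRatio η η' (ω t)) with hS
  set R := ∑ t ∈ Finset.range n, alive t ω with hR
  set Y := stoppedLogRatio η η' n ω with hY
  have hphi : ∀ u : ℝ, 0 ≤ u + Real.exp (-u) - 1 := fun u => by
    linarith [Real.add_one_le_exp (-u)]
  have hS0 : 0 ≤ S := Finset.sum_nonneg fun t _ =>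
    mul_nonneg (alive_nonneg t ω) (Real.exp_pos _).le
  have hR0 : 0 ≤ R := Finset.sum_nonneg fun t _ => alive_nonneg t ω
  have hΦ : Y + S - R = ∑ t ∈ Finset.range n, alive t ω *
      (outcomeLogRatio η η' (ω t) + Real.exp (-outcomeLogRatio η η' (ω t)) - 1) := by
    simp [mul_sub, mul_add, Finset.sum_sub_distrib, Finset.sum_add_distrib, hY, hS, hR,
      stoppedLogRatio]
  have hΦ0 : 0 ≤ Y + S - R := hΦ ▸
    Finset.sum_nonneg fun t _ => mul_nonneg (alive_nonneg t ω) (hphi _)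
  have e1 : ∑ t ∈ Finset.range n,
      ENNReal.ofReal (alive t ω) * ENNReal.ofReal (Real.exp (-outcomeLogRatio η η' (ω t))) =
      ENNReal.ofReal S := by
    rw [hS, ENNReal.ofReal_sum_of_nonneg fun t _ =>
      mul_nonneg (alive_nonneg t ω) (Real.exp_pos _).le]
    exact Finset.sum_congr rfl fun t _ => (ENNReal.ofReal_mul (alive_nonneg t ω)).symm
  have e2 : ∑ t ∈ Finset.range n, ENNReal.ofReal (alive t ω) = ENNReal.ofReal R :=
    (ENNReal.ofReal_sum_of_nonneg fun t _ => alive_nonneg t ω).symm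
  have e3 : ∑ t ∈ Finset.range n, ENNReal.ofReal (alive t ω) *
      ENNReal.ofReal (outcomeLogRatio η η' (ω t) + Real.exp (-outcomeLogRatio η η' (ω t)) - 1) =
      ENNReal.ofReal (Y + S - R) := by
    rw [hΦ, ENNReal.ofReal_sum_of_nonneg fun t _ => mul_nonneg (alive_nonneg t ω) (hphi _)]
    exact Finset.sum_congr rfl fun t _ => (ENNReal.ofReal_mul (alive_nonneg t ω)).symm
  have hE : 0 ≤ Real.exp L - Real.exp (-L) := by
    have := Real.exp_le_exp.2 (show -L ≤ L by linarith)
    linarith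
  have hpos := Real.exp_pos (-L)
  have hposY := Real.exp_pos (-Y)
  rw [e1, e2, e3]
  by_cases h : ω ∈ declaresBefore l n
  · rw [Set.indicator_of_mem h, Set.indicator_of_mem h, Pi.one_apply, mul_one,
      ← ENNReal.ofReal_one, ← ENNReal.ofReal_mul hpos.le, ← ENNReal.ofReal_mul hE,
      ← ENNReal.ofReal_add (by positivity) (by positivity),
      ← ENNReal.ofReal_add (by positivity) (by positivity),
      ← ENNReal.ofReal_add (by positivity) (by positivity),
      ← ENNReal.ofReal_add (by positivity) (by positivity),
      ← ENNReal.ofReal_add (by positivity) (by positivity),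
      ← ENNReal.ofReal_add (by positivity) (by positivity)]
    apply ENNReal.ofReal_le_ofReal
    have := Real.add_one_le_exp (L - Y)
    rw [sub_eq_add_neg, Real.exp_add] at this
    nlinarith
  · rw [Set.indicator_of_notMem h, Set.indicator_of_notMem h, mul_zero, mul_zero, add_zero,
      add_zero, ← ENNReal.ofReal_one, ← ENNReal.ofReal_mul hpos.le,
      ← ENNReal.ofReal_add (by positivity) (by positivity),
      ← ENNReal.ofReal_add (by positivity) (by positivity),
      ← ENNReal.ofReal_add (by positivity) (by positivity),
      ← ENNReal.ofReal_add (by positivity) (by positivity)]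
    apply ENNReal.ofReal_le_ofReal
    have := Real.add_one_le_exp (-L - Y)
    rw [sub_eq_add_neg, Real.exp_add] at this
    linarith

/-- The information gathered bounds the probability of declaring `l` under `η`, if it is unlikely
to declare `l` under `η'`. -/
lemma two_mul_measure_declaresBefore_le (π : Policy K M 𝓧) (η η' : Param F) (l : Fin M) (n : ℕ)
    {α L : ℝ} (hL : 0 ≤ L) (hα : 0 ≤ α)
    (hαL : Real.exp (-L) + (Real.exp L - Real.exp (-L)) * α ≤ 1)
    (h : trajLaw π η' (declaresBefore l n) ≤ ENNReal.ofReal α) :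
    ENNReal.ofReal (2 * L) * trajLaw π η (declaresBefore l n) ≤
      expectedInformation π η η' n + ENNReal.ofReal L := by
  have hmA := measurableSet_declaresBefore (K := K) (𝓧 := 𝓧) l n
  have hE : 0 ≤ Real.exp L - Real.exp (-L) := by
    have := Real.exp_le_exp.2 (show -L ≤ L by linarith)
    linarith
  have hint := lintegral_mono (μ := trajLaw π η)
    (stoppedLogRatio_lower_bound η η' l n hL (M := M))
  rw [lintegral_add_left (by fun_prop), lintegral_add_left (by fun_prop), lintegral_one,
    measure_univ, lintegral_finsetSum _ (fun t _ => by fun_prop),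
    lintegral_const_mul _ (measurable_one.indicator hmA), lintegral_indicator_one hmA,
    lintegral_add_right _ (by fun_prop), lintegral_add_left (by fun_prop),
    lintegral_add_left (by fun_prop), lintegral_add_left (by fun_prop),
    lintegral_finsetSum _ (fun t _ => by fun_prop),
    lintegral_finsetSum _ (fun t _ => by fun_prop), ← expectedInformation_eq,
    lintegral_const_mul _ (by fun_prop), lintegral_stoppedRatio,
    lintegral_const_mul _ (Measurable.indicator (by fun_prop) hmA), lintegral_indicator hmA,
    setLIntegral_stoppedRatio_declaresBefore, lintegral_const, measure_univ, mul_one, mul_one,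
    Finset.sum_congr rfl fun t _ => lintegral_mul_outcomeRatio π η η' t
      (f := fun ω => ENNReal.ofReal (alive t ω)) (by fun_prop)
      (fun ω ω' h => by simp only [alive_congr t h])] at hint
  set R := ∑ t ∈ Finset.range n, ∫⁻ ω, ENNReal.ofReal (alive t ω) ∂(trajLaw π η) with hR
  -- After integration both correction sums equal `R`; being finite, it can be cancelled.
  have hRfin : R ≠ ∞ := by
    refine ENNReal.sum_ne_top.2 fun t _ => ne_top_of_le_ne_top ENNReal.one_ne_top ?_
    calc ∫⁻ ω, ENNReal.ofReal (alive t ω) ∂(trajLaw π η)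
        ≤ ∫⁻ _, 1 ∂(trajLaw π η) := lintegral_mono fun ω => by
          simpa using alive_le_one t ω
      _ = 1 := by simp
  have hone : ENNReal.ofReal (Real.exp (-L)) + ENNReal.ofReal (Real.exp L - Real.exp (-L)) *
      trajLaw π η' (declaresBefore l n) ≤ 1 := by
    calc _ ≤ ENNReal.ofReal (Real.exp (-L)) +
          ENNReal.ofReal (Real.exp L - Real.exp (-L)) * ENNReal.ofReal α := by gcongr
      _ = ENNReal.ofReal (Real.exp (-L) + (Real.exp L - Real.exp (-L)) * α) := by
          rw [← ENNReal.ofReal_mul hE, ← ENNReal.ofReal_add (Real.exp_pos _).le (by positivity)]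
      _ ≤ 1 := by simpa using hαL
  have hfin : 1 + R ≠ ∞ := ENNReal.add_ne_top.2 ⟨ENNReal.one_ne_top, hRfin⟩
  refine (ENNReal.add_le_add_iff_left hfin).1 (hint.trans ?_)
  calc _ ≤ expectedInformation π η η' n + R + 1 + ENNReal.ofReal L := by gcongr
    _ = _ := by ring

end Stopping

/-! ### Counting pulls, and optimising over their proportions. -/

section LowerBound

variable {K M : ℕ} {𝓧 : Type*}

/-- The indicator that arm `a` is pulled at a stage. -/
noncomputable def pullIndicator (a : Fin K) : Outcome K M 𝓧 → ℝ≥0∞ :=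
  Sum.elim (fun _ => 0) (fun p => if p.1 = a then 1 else 0)

/-- A stage not preceded by a stop either stops or pulls exactly one arm. The shift to `t + 1` is
what yields `τ - 1` instead of `τ`. -/
lemma alive_mul_sum_pullIndicator (t : ℕ) (ω : Trajectory K M 𝓧) :
    ENNReal.ofReal (alive t ω) * ∑ a, pullIndicator a (ω t) = ENNReal.ofReal (alive (t + 1) ω) := by
  rcases h : ω t with δ | ⟨b, x⟩
  · rw [alive_of_notMem (k := t + 1)]
    · simp [pullIndicator]
    · intro hr
      have := hr t t.lt_succ_self
      simp [h] at this
  · have : ∑ a, pullIndicator (M := M) a (Sum.inr (b, x)) = 1 := by simp [pullIndicator]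
    rw [this, mul_one]
    by_cases hr : ω ∈ running t
    · rw [alive_of_mem hr, alive_of_mem]
      intro s hs
      rcases Nat.lt_succ_iff_lt_or_eq.1 hs with hs | rfl
      · exact hr s hs
      · simp [h]
    · rw [alive_of_notMem hr, alive_of_notMem (mt (running_anti t.le_succ) hr)]

lemma tsum_alive_le (ω : Trajectory K M 𝓧) :
    ∑' t, ENNReal.ofReal (alive (t + 1) ω) ≤ stopTime ω - 1 := by
  refine ENNReal.le_sub_of_add_le_right ENNReal.one_ne_top (le_iInf₂ fun n hn => ?_)
  gcongr
  rw [tsum_eq_sum (s := Finset.range n)]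
  · calc ∑ t ∈ Finset.range n, ENNReal.ofReal (alive (t + 1) ω)
        ≤ ∑ _t ∈ Finset.range n, 1 := Finset.sum_le_sum fun t _ => by
          simpa using alive_le_one (t + 1) ω
      _ = n := by simp
  · intro t ht
    rw [alive_of_notMem, ENNReal.ofReal_zero]
    intro hr
    have := hr n (by simp at ht; omega)
    simp [hn] at this

variable [MeasurableSpace 𝓧] {F : Fin K → ExpFamily 𝓧}

@[fun_prop]
lemma measurable_pullIndicator (a : Fin K) :
    Measurable (pullIndicator (M := M) (𝓧 := 𝓧) a) :=
  measurable_const.sumElim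
    ((measurable_of_countable fun b : Fin K => if b = a then (1 : ℝ≥0∞) else 0).comp measurable_fst)

lemma outcomeEntropy_eq_sum (η η' : Param F) (y : Outcome K M 𝓧) :
    outcomeEntropy η η' y = ∑ a, pullIndicator a y * (F a).relEntropy (η a) (η' a) := by
  rcases y with δ | ⟨b, x⟩ <;> simp [outcomeEntropy, pullIndicator]

/-- The expected number of pulls of arm `a` before the stop. -/
noncomputable def expectedPulls (π : Policy K M 𝓧) (η : Param F) (a : Fin K) : ℝ≥0∞ :=
  ∑' t, ∫⁻ ω, ENNReal.ofReal (alive t ω) * pullIndicator a (ω t) ∂(trajLaw π η)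

/-- Wald's identity: the finite horizon is dropped and the stages are grouped by the arm pulled. -/
lemma expectedInformation_le (π : Policy K M 𝓧) (η η' : Param F) (n : ℕ) :
    expectedInformation π η η' n ≤
      ∑ a, expectedPulls π η a * (F a).relEntropy (η a) (η' a) := by
  refine (ENNReal.sum_le_tsum _).trans_eq ?_
  simp_rw [expectedPulls, ← ENNReal.tsum_mul_right]
  rw [← Summable.tsum_finsetSum fun _ _ => ENNReal.summable]
  refine tsum_congr fun t => ?_
  simp_rw [outcomeEntropy_eq_sum, Finset.mul_sum, ← mul_assoc]
  rw [lintegral_finsetSum _ fun a _ => by fun_prop]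
  exact Finset.sum_congr rfl fun a _ => lintegral_mul_const _ (by fun_prop)

lemma sum_expectedPulls_le (π : Policy K M 𝓧) (η : Param F) :
    ∑ a, expectedPulls π η a ≤ ∫⁻ ω, (stopTime ω - 1) ∂(trajLaw π η) := by
  refine le_trans (le_of_eq ?_) (lintegral_mono tsum_alive_le)
  simp_rw [expectedPulls]
  rw [← Summable.tsum_finsetSum fun _ _ => ENNReal.summable, lintegral_tsum fun t => by fun_prop]
  refine tsum_congr fun t => ?_
  rw [← lintegral_finsetSum _ fun a _ => by fun_prop]
  simp_rw [← alive_mul_sum_pullIndicator, Finset.mul_sum]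

/-- The expected information gathered before the stop about any alternative is at least the binary
relative entropy of the error probabilities. -/
lemma binaryRelEntropy_le (Θ : Fin M → Set (Param F)) {α : ℝ} (hα0 : 0 < α) (hα1 : α ≤ 1 / 2)
    {l : Fin M} {η η' : Param F} (hη : η ∈ Θ l) (hη' : η' ∈ alternatives Θ l)
    {π : Policy K M 𝓧} (hπ : π ∈ admissible Θ α) :
    ENNReal.ofReal (binaryRelEntropy α (1 - α)) ≤
      ∑ a, expectedPulls π η a * (F a).relEntropy (η a) (η' a) := by
  obtain ⟨hη'U, hη'l⟩ := hη'
  obtain ⟨m, hm⟩ := Set.mem_iUnion.1 hη'U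
  have hml : m ≠ l := fun h => hη'l (h ▸ hm)
  set I := ∑ a, expectedPulls π η a * (F a).relEntropy (η a) (η' a)
  have hα2 : 0 < 1 - α := by linarith
  set L := Real.log ((1 - α) / α) with hLdef
  have hL : 0 ≤ L := Real.log_nonneg ((one_le_div hα0).2 (by linarith))
  have hexp : Real.exp L = (1 - α) / α := Real.exp_log (by positivity)
  have hexp' : Real.exp (-L) = α / (1 - α) := by rw [Real.exp_neg, hexp, inv_div]
  -- Equality holds: `exp (L 1_A - L 1_Aᶜ)` is the likelihood ratio of Bernoulli `1 - α` against
  -- Bernoulli `α`, the optimal test function here.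
  have hαL : Real.exp (-L) + (Real.exp L - Real.exp (-L)) * α ≤ 1 := by
    rw [hexp, hexp']
    apply le_of_eq
    field_simp
    ring
  -- Under `η' ∈ Θ m`, declaring `l` is an error.
  have hsub : ∀ n, declaresBefore (K := K) (𝓧 := 𝓧) l n ⊆ {ω | decision ω ≠ some m} := by
    intro n ω hω hdec
    have h : decision ω = some l := (setOf_decision_eq l).ge (Set.mem_iUnion.2 ⟨n, hω⟩)
    exact hml (Option.some.inj (hdec.symm.trans h))
  have hn : ∀ n, ENNReal.ofReal (2 * L) * trajLaw π η (declaresBefore l n) ≤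
      I + ENNReal.ofReal L := fun n =>
    (two_mul_measure_declaresBefore_le π η η' l n hL hα0.le hαL
      ((measure_mono (hsub n)).trans (hπ m η' hm))).trans
        (by gcongr; exact expectedInformation_le π η η' n)
  have hlim : ENNReal.ofReal (2 * L) * trajLaw π η {ω | decision ω = some l} ≤
      I + ENNReal.ofReal L := by
    rw [setOf_decision_eq, (declaresBefore_mono l).measure_iUnion, ENNReal.mul_iSup]
    exact iSup_le hn
  have hprob : ENNReal.ofReal (1 - α) ≤ trajLaw π η {ω | decision ω = some l} := by
    have hmeas : MeasurableSet {ω : Trajectory K M 𝓧 | decision ω = some l} := by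
      rw [setOf_decision_eq]
      exact MeasurableSet.iUnion fun n => measurableSet_declaresBefore l n
    have hc : trajLaw π η {ω | decision ω = some l}ᶜ ≤ ENNReal.ofReal α := hπ l η hη
    rw [prob_compl_eq_one_sub hmeas] at hc
    rw [ENNReal.ofReal_sub _ hα0.le, ENNReal.ofReal_one]
    exact tsub_le_iff_left.2 (tsub_le_iff_right.1 hc)
  have hd : binaryRelEntropy α (1 - α) = 2 * L * (1 - α) - L := by
    have h1 : Real.log (α / (1 - α)) = -L := by rw [hLdef, ← Real.log_inv, inv_div]
    rw [binaryRelEntropy, h1, sub_sub_cancel, ← hLdef]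
    ring
  rw [hd, ENNReal.ofReal_sub _ hL, ENNReal.ofReal_mul (by positivity)]
  exact tsub_le_iff_right.2 (le_trans (by gcongr) hlim)

/-- Optimising over the proportions of the pulls of the arms. -/
lemma div_iSup_iInf_le {ι : Type*} [Fintype ι] [Nonempty ι] {β : Type*} (B : Set β)
    (D : β → ι → ℝ≥0∞) (N : ι → ℝ≥0∞) (c : ℝ≥0∞) (h : ∀ b ∈ B, c ≤ ∑ i, N i * D b i) :
    c / (⨆ w ∈ stdSimplex ℝ ι, ⨅ b ∈ B, ∑ i, ENNReal.ofReal (w i) * D b i) ≤ ∑ i, N i := by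
  classical
  set S := ∑ i, N i with hS
  rcases eq_or_ne S ∞ with hT | hT
  · rw [hT]; exact le_top
  rcases eq_or_ne S 0 with h0 | h0
  · rcases B.eq_empty_or_nonempty with rfl | ⟨b, hb⟩
    -- Without alternatives the supremum is `∞` because the simplex is nonempty.
    · have hne : (stdSimplex ℝ ι).Nonempty :=
        ⟨_, single_mem_stdSimplex ℝ (Classical.arbitrary ι)⟩
      obtain ⟨w, hw⟩ := hne
      have : (⨆ w ∈ stdSimplex ℝ ι, ⨅ b ∈ (∅ : Set β), ∑ i, ENNReal.ofReal (w i) * D b i) = ⊤ :=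
        top_le_iff.1 (le_iSup₂_of_le w hw (by simp))
      rw [this, ENNReal.div_top]
      exact zero_le
    · have hN : ∀ i, N i = 0 := fun i => Finset.sum_eq_zero_iff.1 h0 i (Finset.mem_univ i)
      have hc : c = 0 := by simpa [hN] using h b hb
      rw [hc, ENNReal.zero_div]
      exact zero_le
  · have hNT : ∀ i, N i ≠ ∞ := fun i => ENNReal.sum_ne_top.1 hT i (Finset.mem_univ i)
    -- The witness is the vector of pull proportions; against every alternative it gains at least `c
    -- / S`.
    have hw : (fun i => (N i / S).toReal) ∈ stdSimplex ℝ ι := by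
      refine ⟨fun i => ENNReal.toReal_nonneg, ?_⟩
      rw [← ENNReal.toReal_sum fun i _ => ENNReal.div_ne_top (hNT i) h0]
      simp_rw [div_eq_mul_inv]
      rw [← Finset.sum_mul, ← hS, ENNReal.mul_inv_cancel h0 hT, ENNReal.toReal_one]
    refine ENNReal.div_le_of_le_mul ?_
    have hle : c / S ≤ ⨆ w ∈ stdSimplex ℝ ι, ⨅ b ∈ B, ∑ i, ENNReal.ofReal (w i) * D b i := by
      refine le_iSup₂_of_le _ hw (le_iInf₂ fun b hb => ?_)
      refine ENNReal.div_le_of_le_mul ((h b hb).trans_eq ?_)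
      rw [Finset.sum_mul]
      refine Finset.sum_congr rfl fun i _ => ?_
      rw [ENNReal.ofReal_toReal (ENNReal.div_ne_top (hNT i) h0), mul_right_comm,
        ENNReal.div_mul_cancel h0 hT]
    calc c = S * (c / S) := (ENNReal.mul_div_cancel h0 hT).symm
      _ ≤ _ := by gcongr

end LowerBound

end BanditTest

theorem proposition1 {𝓧 : Type*} [MeasurableSpace 𝓧] (K M : ℕ) (hK : 1 ≤ K)
    (F : Fin K → BanditTest.ExpFamily 𝓧)
    (Θ : Fin M → Set (BanditTest.Param F))
    (hΘ : Pairwise (fun m m' => Disjoint (Θ m) (Θ m')))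
    (α : ℝ) (hα0 : 0 < α) (hα1 : α ≤ 1 / 2)
    (l : Fin M) (η : BanditTest.Param F) (hη : η ∈ Θ l)
    (π : BanditTest.Policy K M 𝓧) (hπ : π ∈ BanditTest.admissible Θ α)
    (g : Fin K → Fin K → ℝ≥0) (hg : ∀ a, g a a = 0) :
    ENNReal.ofReal (BanditTest.binaryRelEntropy α (1 - α)) / BanditTest.Dstar Θ l η
        ≤ ∫⁻ ω, BanditTest.stopTime ω ∂(BanditTest.trajLaw π η) ∧
      ENNReal.ofReal (BanditTest.binaryRelEntropy α (1 - α)) / BanditTest.Dstar Θ l η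
        ≤ ∫⁻ ω, (BanditTest.stopTime ω - 1) ∂(BanditTest.trajLaw π η) ∧
      ENNReal.ofReal (BanditTest.binaryRelEntropy α (1 - α)) / BanditTest.Dstar Θ l η
        ≤ ∫⁻ ω, BanditTest.totalCost g ω ∂(BanditTest.trajLaw π η) := by
  have : Nonempty (Fin K) := ⟨⟨0, hK⟩⟩
  have hmain : ENNReal.ofReal (BanditTest.binaryRelEntropy α (1 - α)) / BanditTest.Dstar Θ l η
      ≤ ∫⁻ ω, (BanditTest.stopTime ω - 1) ∂(BanditTest.trajLaw π η) :=
    (BanditTest.div_iSup_iInf_le _ _ (BanditTest.expectedPulls π η) _ fun _ hη' =>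
      BanditTest.binaryRelEntropy_le Θ hα0 hα1 hη hη' hπ).trans
        (BanditTest.sum_expectedPulls_le π η)
  -- The other two bounds follow from `τ - 1 ≤ τ ≤ C`.
  have hτ := hmain.trans (lintegral_mono fun _ => tsub_le_self)
  exact ⟨hτ, hmain, hτ.trans (lintegral_mono fun _ => le_self_add)⟩
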